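/- Let $d\ge 1$, let $n_1,\dots,n_d$ be non-negative integers, and equip the space $E=\mathbb{C}^{n_1\times\cdots\times n_d}$ of complex tensors with the Frobenius norm $\|\mathcal X\|_F=\big(\sum_{i_1,\dots,i_d}|\mathcal X(i_1,\dots,i_d)|^2\big)^{1/2}$. For $1\le k\le d-1$ let $\mathbf X_{\langle k\rangle}\in\mathbb{C}^{(n_1\cdots n_k)\times(n_{k+1}\cdots n_d)}$ be the $k$-th unfolding of $\mathcal X$, whose rows are indexed by $(i_1,\dots,i_k)$ and whose columns by $(i_{k+1},\dots,i_d)$, and let $\mathrm{rank}_{\mathrm{TT}}(\mathcal X)=(1,\mathrm{rank}\,\mathbf X_{\langle 1\rangle},\dots,\mathrm{rank}\,\mathbf X_{\langle d-1\rangle},1)$. For an array $\mathbf r=(r_0,r_1,\dots,r_{d-1},r_d)$ of non-negative integers (only $r_0=r_d=1$ is of interest) put $$\mathcal M_{\mathbf r}=\{\mathcal X\in E:\mathrm{rank}_{\mathrm{TT}}(\mathcal X)=\mathbf r\},\quad \mathcal B_1=\{\mathcal X\in E:\|\mathcal X\|_F=1\},\quad \mathcal N_{\mathbf r}=\{\mathcal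 X\in E:\mathrm{rank}_{\mathrm{TT}}(\mathcal X)=\mathbf r,\ \|\mathcal X\|_F=1\},$$ $$D=\sum_{k=1}^{d}r_{k-1}n_kr_k-\sum_{k=1}^{d-1}r_k^2 .$$ A subset $S$ of a finite-dimensional vector space $V$ over $\mathbb K\in\{\mathbb R,\mathbb C\}$ is called an embedded submanifold of dimension $m$ if every $x\in S$ has an open neighbourhood $U$ in $V$ with a smooth (for $\mathbb K=\mathbb C$: holomorphic) map $h:U\to\mathbb K^k$, $k=\dim_{\mathbb K}V-m$, such that $S\cap U=h^{-1}(0)$ and $\mathrm Dh(x)$ has rank $k$; the empty set is a submanifold of every dimension. The tangent space $T_xS$ is the set of the velocities $\gamma'(0)$ of smooth curves $\gamma:(-\varepsilon,\varepsilon)\to S$ of a real variable with $\gamma(0)=x$. Then: 1. $\mathcal M_{\mathbf r}$ is a complex embedded submanifold of $E$ of complex dimension $D$; as a subset of the real vector space $E$ it is a smooth embedded submanifold of real dimension $2D$. The sphere $\mathcal B_1$ is a smooth embedded submanifold of real dimension $2n_1\cdots n_d-1$. 2. $\mathcal N_{\mathbf r}=\mathcal M_{\mathbf r}\cap\mathcal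 B_1$. 3. For every $\mathcal X\in\mathcal M_{\mathbf r}$ and every $t\in\mathbb C$, $t\mathcal X\in T_{\mathcal X}\mathcal M_{\mathbf r}$; in particular $\mathcal X\in T_{\mathcal X}\mathcal M_{\mathbf r}$. 4. $\mathcal M_{\mathbf r}$ and $\mathcal B_1$ intersect transversally: $T_{\mathcal X}\mathcal M_{\mathbf r}+T_{\mathcal X}\mathcal B_1=E$ for every $\mathcal X\in\mathcal N_{\mathbf r}$. 5. $\mathcal N_{\mathbf r}$ is a smooth embedded submanifold of the real vector space $E$, of real dimension $2D-1$, that is, one less than the real dimension of $\mathcal M_{\mathbf r}$. -/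

import Mathlib

open scoped ContDiff

noncomputable section

/-- A subset `S` of a finite-dimensional normed space `E` over `𝕜` is an embedded submanifold of
`𝕜`-dimension `m` if near every point `x` of `S` it is the zero set of a `C^∞` map
`h : U → 𝕜 ^ k`, where `m + k = dim E` and the differential of `h` at `x` has full rank `k`.
For `𝕜 = ℝ` this is a smooth submanifold, and for `𝕜 = ℂ` (where `h` is holomorphic) a complex
submanifold. The empty set is a submanifold of every dimension. -/
def IsEmbeddedSubmanifold (𝕜 : Type*) [RCLike 𝕜] {E : Type*} [NormedAddCommGroup E]
    [NormedSpace 𝕜 E] (S : Set E) (m : ℤ) : Prop :=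
  ∀ x ∈ S, ∃ (k : ℕ) (U : Set E) (h : E → Fin k → 𝕜),
    m + (k : ℤ) = (Module.finrank 𝕜 E : ℤ) ∧
    IsOpen U ∧ x ∈ U ∧ ContDiffOn 𝕜 ∞ h U ∧
    (∀ y ∈ U, y ∈ S ↔ h y = 0) ∧
    Function.Surjective (fderiv 𝕜 h x)

/-- The tangent space of `S` at `x`: the velocities at time `0` of the smooth curves that are
defined near `0`, run inside `S` and pass through `x` at time `0`. -/
def tangentSpaceAt {E : Type*} [NormedAddCommGroup E] [NormedSpace ℝ E] (S : Set E) (x : E) :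
    Set E :=
  {v | ∃ (ε : ℝ) (γ : ℝ → E), 0 < ε ∧ ContDiffOn ℝ ∞ γ (Set.Ioo (-ε) ε) ∧
    (∀ t ∈ Set.Ioo (-ε) ε, γ t ∈ S) ∧ γ 0 = x ∧ HasDerivAt γ v 0}

/-- `S` and `T` intersect transversally: `T_x S + T_x T = E` at every point `x ∈ S ∩ T`. -/
def IntersectTransversally {E : Type*} [NormedAddCommGroup E] [NormedSpace ℝ E]
    (S T : Set E) : Prop :=
  ∀ x ∈ S ∩ T, ∀ w : E, ∃ u ∈ tangentSpaceAt S x, ∃ v ∈ tangentSpaceAt T x, u + v = w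

/-- Complex `n₁ × ⋯ × n_d` tensors, with the Frobenius norm. The mode that is usually numbered
`j + 1` has the index `j : Fin d`. -/
abbrev CTensor {d : ℕ} (n : Fin d → ℕ) : Type :=
  EuclideanSpace ℂ ((j : Fin d) → Fin (n j))

/-- The `k`-th unfolding matrix: the multi-index of the first `k` modes is the row index, that of
the remaining modes is the column index. -/
def CTensor.unfolding {d : ℕ} {n : Fin d → ℕ} (X : CTensor n) (k : ℕ) :
    Matrix ((j : {j : Fin d // (j : ℕ) < k}) → Fin (n j))
      ((j : {j : Fin d // ¬ (j : ℕ) < k}) → Fin (n j)) ℂ :=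
  Matrix.of fun a b =>
    X ((Equiv.piEquivPiSubtypeProd (fun j : Fin d => (j : ℕ) < k) fun j => Fin (n j)).symm (a, b))

/-- The TT rank `(1, rank X_⟨1⟩, …, rank X_⟨d-1⟩, 1)`. -/
def CTensor.ttRank {d : ℕ} {n : Fin d → ℕ} (X : CTensor n) : Fin (d + 1) → ℕ :=
  fun k => if k = 0 ∨ k = Fin.last d then 1 else (X.unfolding (k : ℕ)).rank

/-- The set `M_r` of tensors of TT rank exactly `r = (r₀, …, r_d)`. -/
def fixedTTRank {d : ℕ} (n : Fin d → ℕ) (r : Fin (d + 1) → ℕ) : Set (CTensor n) :=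
  {X | X.ttRank = r}

/-- The set `N_r` of tensors of TT rank exactly `r` and of unit Frobenius norm. -/
def fixedNTTRank {d : ℕ} (n : Fin d → ℕ) (r : Fin (d + 1) → ℕ) : Set (CTensor n) :=
  {X | X.ttRank = r ∧ ‖X‖ = 1}

/-- The unit sphere `B₁` for the Frobenius norm. -/
def unitTensorSphere {d : ℕ} (n : Fin d → ℕ) : Set (CTensor n) :=
  {X | ‖X‖ = 1}

/-- The number `∑_{k=1}^{d} r_{k-1} n_k r_k - ∑_{k=1}^{d-1} r_k²`. -/
def ttDim {d : ℕ} (n : Fin d → ℕ) (r : Fin (d + 1) → ℕ) : ℤ :=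
  ∑ j : Fin d, (r j.castSucc : ℤ) * (n j : ℤ) * (r j.succ : ℤ) -
    ∑ k ∈ Finset.Ioo (0 : Fin (d + 1)) (Fin.last d), (r k : ℤ) ^ 2

end

/-!
Near a tensor `X` of TT rank `r`, the set of tensors of that rank is the graph of a holomorphic
function of `ttDim n r` of the entries. This is the mechanism behind cross interpolation.

At every inner level `k` there are `r k` rows and `r k` columns of the `k`-th unfolding of `X` that
span its row and column space. They can be chosen nested: a spanning set of rows of level `k`,
extended by all values of the next index, spans the rows of level `k + 1`, and dually for columns
(`exists_nestedPivots`). Pivot rows and columns of one level meet in an invertible matrix, and this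
remains true on an open set, `NestedPivots.domain`. There, a tensor whose `k`-th unfolding has rank
`r k` equals its cross approximation `cross k`, which is built from its pivot rows and columns of
level `k` only. Because of the nesting, `cross k` leaves alone all *free* entries, those whose index
starts with a row pivot of some level `m` and ends, behind the next mode, with a column pivot of
level `m + 1`. Since `cross l` does not raise the ranks of the unfoldings below level `l`, the
composite of all these maps, `retraction`, is a smooth retraction of the domain onto the tensors of
TT rank `r`. Such a tensor is determined by its free entries (`eq_of_eq_on_support`), so the
retraction depends on the free entries only. Hence the other entries of `y - retraction y` are
local equations whose differential is onto, without any formula for the derivative of the retraction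
(`exists_local_equations_of_coordinate_retraction`). The levels at which a fixed index is free form
an interval, and inclusion–exclusion along it counts the free entries (`card_support`).

The set is a cone over the nonzero scalars. So `exp (s t) X` is a curve with velocity `t X`, the
radial direction complements the tangent space of the sphere, and adding the equation
`‖y‖ ^ 2 - 1 = 0` to local equations of the cone keeps the differential onto
(`IsEmbeddedSubmanifold.inter_sphere`).
-/

/-! ### Submanifolds of normed spaces -/

/-- Restriction of scalars turns a complex submanifold into a real one of twice the dimension. -/
theorem IsEmbeddedSubmanifold.real_of_complex {E : Type*} [NormedAddCommGroup E]
    [NormedSpace ℂ E] [NormedSpace ℝ E] [IsScalarTower ℝ ℂ E] {S : Set E} {m : ℤ}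
    (hS : IsEmbeddedSubmanifold ℂ S m) : IsEmbeddedSubmanifold ℝ S (2 * m) := by
  intro x hx
  obtain ⟨k, U, h, hdim, hU, hxU, hsm, hzero, hsurj⟩ := hS x hx
  have hfin : Module.finrank ℝ (Fin k → ℂ) = Module.finrank ℝ (Fin (2 * k) → ℝ) := by
    rw [finrank_real_of_complex]; simp
  let L : (Fin k → ℂ) ≃L[ℝ] (Fin (2 * k) → ℝ) := ContinuousLinearEquiv.ofFinrankEq hfin
  have hE : Module.finrank ℝ E = 2 * Module.finrank ℂ E := by
    rw [← Module.finrank_mul_finrank ℝ ℂ E, Complex.finrank_real_complex]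
  refine ⟨2 * k, U, fun y => L (h y), ?_, hU, hxU, ?_, ?_, ?_⟩
  · rw [hE]; push_cast; linarith
  · exact L.contDiff.comp_contDiffOn (hsm.restrict_scalars ℝ)
  · intro y hy
    rw [hzero y hy]
    exact (map_eq_zero_iff L L.injective).symm
  · have hd : DifferentiableAt ℂ h x :=
      (hsm.contDiffAt (hU.mem_nhds hxU)).differentiableAt (by simp)
    have hder := (hd.hasFDerivAt.restrictScalars ℝ)
    have h2 : HasFDerivAt (fun y => L (h y))
        ((L : (Fin k → ℂ) →L[ℝ] (Fin (2 * k) → ℝ)).comp ((fderiv ℂ h x).restrictScalars ℝ)) x :=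
      L.hasFDerivAt.comp x hder
    rw [h2.fderiv]
    exact L.surjective.comp hsurj

/-- A submanifold that is invariant under positive scalings meets the unit sphere in a submanifold
of codimension one: the radial direction is tangent to the former and transverse to the latter. -/
theorem IsEmbeddedSubmanifold.inter_sphere {E : Type*} [NormedAddCommGroup E]
    [InnerProductSpace ℝ E] {S : Set E} {m : ℤ} (hS : IsEmbeddedSubmanifold ℝ S m)
    (hcone : ∀ x ∈ S, ∀ t : ℝ, 0 < t → t • x ∈ S) :
    IsEmbeddedSubmanifold ℝ (S ∩ {x | ‖x‖ = 1}) (m - 1) := by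
  rintro x ⟨hx, hx1⟩
  obtain ⟨k, U, h, hdim, hU, hxU, hsm, hzero, hsurj⟩ := hS x hx
  have hsq : ContDiff ℝ ∞ fun y : E => ‖y‖ ^ 2 - 1 := (contDiff_norm_sq ℝ).sub contDiff_const
  have hd : DifferentiableAt ℝ h x :=
    (hsm.contDiffAt (hU.mem_nhds hxU)).differentiableAt (by simp)
  have hgd : HasFDerivAt (fun y : E => ‖y‖ ^ 2 - 1) (2 • innerSL ℝ x) x :=
    (hasStrictFDerivAt_norm_sq x).hasFDerivAt.sub_const 1
  have hradial : fderiv ℝ h x x = 0 := by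
    have hline : HasDerivAt (fun s : ℝ => (1 + s) • x) x 0 := by
      simpa using ((hasDerivAt_id (0 : ℝ)).const_add 1).smul_const x
    have hcomp : HasDerivAt (fun s : ℝ => h ((1 + s) • x)) (fderiv ℝ h x x) 0 := by
      have := HasFDerivAt.comp_hasDerivAt (x := (0 : ℝ)) (f := fun s : ℝ => (1 + s) • x)
        (l := h) (l' := fderiv ℝ h x) (f' := x) (by simpa using hd.hasFDerivAt) hline
      exact this
    have hev : (fun s : ℝ => h ((1 + s) • x)) =ᶠ[nhds 0] fun _ => 0 := by
      have hnear : ∀ᶠ s : ℝ in nhds 0, (1 + s) • x ∈ U :=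
        hline.continuousAt.eventually_mem (hU.mem_nhds (by simpa using hxU))
      filter_upwards [hnear, lt_mem_nhds (show (-1 : ℝ) < 0 by norm_num)] with s hs hs1
      exact (hzero _ hs).1 (hcone x hx _ (by linarith))
    exact hcomp.unique ((hasDerivAt_const (0 : ℝ) (0 : Fin k → ℝ)).congr_of_eventuallyEq hev)
  refine ⟨k + 1, U, fun y => Fin.cons (‖y‖ ^ 2 - 1) (h y), by push_cast; linarith, hU, hxU,
    ?_, ?_, ?_⟩
  · refine contDiffOn_pi.2 fun i => ?_
    refine Fin.cases ?_ (fun j => ?_) i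
    · simpa using hsq.contDiffOn
    · simpa using contDiffOn_pi.1 hsm j
  · intro y hy
    have h1 : ‖y‖ = 1 ↔ ‖y‖ ^ 2 - 1 = 0 := by
      rw [sub_eq_zero, pow_eq_one_iff_of_nonneg (norm_nonneg y) two_ne_zero]
    rw [Set.mem_inter_iff, hzero y hy, Set.mem_ofPred_eq, h1, and_comm]
    constructor
    · rintro ⟨a, b⟩
      funext i
      refine Fin.cases ?_ (fun j => ?_) i
      · simpa using a
      · simpa using congrFun b j
    · intro a
      exact ⟨by simpa using congrFun a 0, funext fun j => by simpa using congrFun a j.succ⟩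
  · have hder : HasFDerivAt (fun y => (Fin.cons (‖y‖ ^ 2 - 1) (h y) : Fin (k + 1) → ℝ))
        (ContinuousLinearMap.pi (Fin.cons (2 • innerSL ℝ x)
          fun j => (ContinuousLinearMap.proj j).comp (fderiv ℝ h x))) x := by
      refine hasFDerivAt_pi'' fun i => ?_
      refine Fin.cases ?_ (fun j => ?_) i
      · simpa using hgd
      · simpa using hasFDerivAt_pi'.1 hd.hasFDerivAt j
    rw [hder.fderiv]
    intro w
    obtain ⟨v, hv⟩ := hsurj fun j => w j.succ
    -- a radial component adjusts the first coordinate and leaves the others unchanged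
    refine ⟨v + ((w 0 - 2 * inner ℝ x v) / 2) • x, ?_⟩
    funext i
    refine Fin.cases ?_ (fun j => ?_) i
    · simp only [ContinuousLinearMap.pi_apply, Fin.cons_zero]
      rw [map_add, map_smul]
      have hx1 : ‖x‖ = 1 := hx1
      simp [hx1]
    · simp only [ContinuousLinearMap.pi_apply, Fin.cons_succ, ContinuousLinearMap.comp_apply]
      rw [map_add, map_smul, hradial, smul_zero, add_zero, hv]
      rfl

theorem isEmbeddedSubmanifold_univ {𝕜 : Type*} [RCLike 𝕜] {E : Type*} [NormedAddCommGroup E]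
    [NormedSpace 𝕜 E] : IsEmbeddedSubmanifold 𝕜 (Set.univ : Set E) (Module.finrank 𝕜 E) := by
  intro x _
  refine ⟨0, Set.univ, fun _ => 0, by simp, isOpen_univ, trivial, contDiffOn_const, ?_, ?_⟩
  · intro y _; simp
  · intro w; exact ⟨0, Subsingleton.elim _ _⟩

/-- If a smooth map `G` fixes exactly the points of `S` in `U`, leaves the coordinates in `P`
unchanged and depends on them only, then `S` is near `x` the graph of a smooth function of the
coordinates in `P`; the remaining coordinates of `y - G y` are local equations for `S`. -/
theorem exists_local_equations_of_coordinate_retraction {𝕜 ι : Type*} [RCLike 𝕜] [Fintype ι]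
    (P : ι → Prop) [DecidablePred P] {S U : Set (EuclideanSpace 𝕜 ι)}
    (G : EuclideanSpace 𝕜 ι → EuclideanSpace 𝕜 ι) (hU : IsOpen U) (hG : ContDiffOn 𝕜 ∞ G U)
    (hfix : ∀ y ∈ U, y ∈ S ↔ G y = y) (hkeep : ∀ y ∈ U, ∀ i, P i → G y i = y i)
    (hdep : ∀ y ∈ U, ∀ z ∈ U, (∀ i, P i → y i = z i) → G y = G z)
    {x : EuclideanSpace 𝕜 ι} (hx : x ∈ U) :
    ∃ (k : ℕ) (U : Set (EuclideanSpace 𝕜 ι)) (h : EuclideanSpace 𝕜 ι → Fin k → 𝕜),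
      (Fintype.card {i // P i} : ℤ) + (k : ℤ) = (Module.finrank 𝕜 (EuclideanSpace 𝕜 ι) : ℤ) ∧
      IsOpen U ∧ x ∈ U ∧ ContDiffOn 𝕜 ∞ h U ∧ (∀ y ∈ U, y ∈ S ↔ h y = 0) ∧
      Function.Surjective (fderiv 𝕜 h x) := by
  classical
  let e : Fin (Fintype.card {i // ¬ P i}) ≃ {i // ¬ P i} := (Fintype.equivFin _).symm
  have hcoord : ∀ i, ContDiffOn 𝕜 ∞ (fun y => y i - G y i) U := fun i =>
    (contDiffOn_euclidean.1 contDiffOn_id i).sub (contDiffOn_euclidean.1 hG i)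
  have hsm : ContDiffOn 𝕜 ∞ (fun y (j : Fin (Fintype.card {i // ¬ P i})) =>
      y (e j) - G y (e j)) U := contDiffOn_pi.2 fun j => hcoord _
  refine ⟨Fintype.card {i // ¬ P i}, U, _, ?_, hU, hx, hsm, ?_, ?_⟩
  · rw [finrank_euclideanSpace, Fintype.card_subtype_compl]
    have := Fintype.card_subtype_le P
    omega
  · intro y hy
    rw [hfix y hy]
    constructor
    · intro h
      funext j
      simp [h]
    · intro h
      ext i
      by_cases hi : P i
      · exact hkeep y hy i hi
      · have := congrFun h (e.symm ⟨i, hi⟩)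
        simp only [Equiv.apply_symm_apply, Pi.zero_apply] at this
        exact (sub_eq_zero.1 this).symm
  · intro w
    let v : EuclideanSpace 𝕜 ι :=
      WithLp.toLp 2 fun i => if hi : P i then 0 else w (e.symm ⟨i, hi⟩)
    have hvP : ∀ i, P i → v i = 0 := fun i hi => by simp [v, hi]
    have hve : ∀ j, v (e j) = w j := fun j => by simp [v, (e j).2]
    refine ⟨v, ?_⟩
    have hd := (hsm.contDiffAt (hU.mem_nhds hx)).differentiableAt (by simp)
    have hline : HasDerivAt (fun s : 𝕜 => x + s • v) v 0 := by
      simpa using ((hasDerivAt_id (0 : 𝕜)).smul_const v).const_add x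
    have hcomp := HasFDerivAt.comp_hasDerivAt (x := (0 : 𝕜)) (f := fun s : 𝕜 => x + s • v)
      (f' := v) (by rw [zero_smul, add_zero]; exact hd.hasFDerivAt) hline
    refine hcomp.unique (HasDerivAt.congr_of_eventuallyEq
      (f := fun s : 𝕜 => (fun j => x (e j) - G x (e j)) + s • w) ?_ ?_)
    · simpa using ((hasDerivAt_id (0 : 𝕜)).smul_const w).const_add
        fun j => x (e j) - G x (e j)
    · have hnear : ∀ᶠ s : 𝕜 in nhds 0, x + s • v ∈ U :=
        hline.continuousAt.eventually_mem (hU.mem_nhds (by simpa using hx))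
      filter_upwards [hnear] with s hs
      -- `v` changes no coordinate in `P`, so `G` is constant along the line
      have hGs : G (x + s • v) = G x := hdep _ hs _ hx fun i hi => by simp [hvP i hi]
      funext j
      simp [hGs, hve]
      ring

/-! ### Tangent vectors -/

/-- A vector `v` orthogonal to `x` is the velocity of the line `x + s v` projected radially to the
sphere. -/
theorem mem_tangentSpaceAt_sphere {E : Type*} [NormedAddCommGroup E] [InnerProductSpace ℝ E]
    {x v : E} (hx : ‖x‖ = 1) (hv : inner ℝ x v = 0) :
    v ∈ tangentSpaceAt {y : E | ‖y‖ = 1} x := by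
  have hpos : ∀ s : ℝ, 0 < 1 + s ^ 2 * ‖v‖ ^ 2 := fun s => by positivity
  have hnorm : ∀ s : ℝ, ‖x + s • v‖ ^ 2 = 1 + s ^ 2 * ‖v‖ ^ 2 := fun s => by
    rw [norm_add_sq_real, inner_smul_right, hv, hx, norm_smul, mul_pow, Real.norm_eq_abs, sq_abs]
    ring
  have hq : ContDiff ℝ ∞ fun s : ℝ => (√(1 + s ^ 2 * ‖v‖ ^ 2))⁻¹ :=
    (ContDiff.sqrt (by fun_prop) fun s => (hpos s).ne').inv fun s => (Real.sqrt_pos.2 (hpos s)).ne'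
  refine ⟨1, fun s => (√(1 + s ^ 2 * ‖v‖ ^ 2))⁻¹ • (x + s • v), one_pos,
    (hq.smul (by fun_prop)).contDiffOn, ?_, by simp, ?_⟩
  · intro s _
    rw [Set.mem_ofPred_eq, norm_smul, ← hnorm, Real.sqrt_sq (norm_nonneg _), norm_inv, norm_norm]
    refine inv_mul_cancel₀ fun h => ?_
    have := hnorm s
    rw [h] at this
    linarith [hpos s]
  · have hline : HasDerivAt (fun s : ℝ => x + s • v) v 0 := by
      simpa using ((hasDerivAt_id (0 : ℝ)).smul_const v).const_add x
    have hinner : HasDerivAt (fun s : ℝ => 1 + s ^ 2 * ‖v‖ ^ 2) 0 0 := by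
      simpa using (((hasDerivAt_id (0 : ℝ)).pow 2).mul_const (‖v‖ ^ 2)).const_add 1
    have hroot : HasDerivAt (fun s : ℝ => (√(1 + s ^ 2 * ‖v‖ ^ 2))⁻¹) 0 0 := by
      have h := (hinner.sqrt (by simp)).inv (by simp)
      simp only [zero_div, neg_zero] at h
      exact h
    have h := hroot.smul hline
    simp only [zero_smul, add_zero, ne_eq, OfNat.ofNat_ne_zero, not_false_eq_true, zero_pow,
      zero_mul, Real.sqrt_one, inv_one, one_smul] at h
    exact h

/-- A set that is invariant under nonzero complex scalings contains the curves `s ↦ exp (s t) x`. -/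
theorem smul_mem_tangentSpaceAt {E : Type*} [NormedAddCommGroup E] [NormedSpace ℂ E]
    [NormedSpace ℝ E] [IsScalarTower ℝ ℂ E] {S : Set E}
    (hS : ∀ x ∈ S, ∀ c : ℂ, c ≠ 0 → c • x ∈ S) {x : E} (hx : x ∈ S) (t : ℂ) :
    t • x ∈ tangentSpaceAt S x := by
  refine ⟨1, fun s => Complex.exp (s * t) • x, one_pos, ?_, fun s _ =>
    hS x hx _ (Complex.exp_ne_zero _), by simp, ?_⟩
  · refine ContDiff.contDiffOn (ContDiff.smul (ContDiff.cexp ?_) contDiff_const)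
    exact Complex.ofRealCLM.contDiff.mul contDiff_const
  · have h1 : HasDerivAt (fun s : ℝ => (s : ℂ) * t) t 0 := by
      simpa using (Complex.ofRealCLM.hasDerivAt (x := 0)).mul_const t
    simpa using h1.cexp.smul_const x

/-! ### Multi-indices and nested pivots -/

section TensorTrain

/-- Multi-indices of an `n₁ × ⋯ × n_d` tensor. -/
abbrev MultiIndex {d : ℕ} (n : Fin d → ℕ) : Type := (j : Fin d) → Fin (n j)

variable {d : ℕ} {n : Fin d → ℕ}

/-- The multi-index that agrees with `a` in the first `k` modes and with `b` in the others. -/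
def glue (k : ℕ) (a b : MultiIndex n) : MultiIndex n := fun j => if (j : ℕ) < k then a j else b j

theorem glue_of_lt {k : ℕ} {j : Fin d} (h : (j : ℕ) < k) (a b : MultiIndex n) :
    glue k a b j = a j := if_pos h

theorem glue_of_le {k : ℕ} {j : Fin d} (h : k ≤ (j : ℕ)) (a b : MultiIndex n) :
    glue k a b j = b j := if_neg h.not_gt

theorem glue_congr {k : ℕ} {a a' b b' : MultiIndex n} (ha : ∀ j : Fin d, (j : ℕ) < k → a j = a' j)
    (hb : ∀ j : Fin d, k ≤ (j : ℕ) → b j = b' j) : glue k a b = glue k a' b' := by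
  funext j
  rcases lt_or_ge (j : ℕ) k with h | h
  · rw [glue_of_lt h, glue_of_lt h, ha j h]
  · rw [glue_of_le h, glue_of_le h, hb j h]

@[simp] theorem glue_self (k : ℕ) (a : MultiIndex n) : glue k a a = a := by
  funext j; simp [glue]

@[simp] theorem glue_glue_left (k : ℕ) (a b c : MultiIndex n) :
    glue k (glue k a b) c = glue k a c :=
  glue_congr (fun _ h => glue_of_lt h _ _) fun _ _ => rfl

@[simp] theorem glue_glue_right (k : ℕ) (a b c : MultiIndex n) :
    glue k a (glue k b c) = glue k a c :=
  glue_congr (fun _ _ => rfl) fun _ h => glue_of_le h _ _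

theorem glue_glue_of_ge {k l : ℕ} (h : k ≤ l) (a b c : MultiIndex n) :
    glue l a (glue k b c) = glue l a c :=
  glue_congr (fun _ _ => rfl) fun _ hj => glue_of_le (h.trans hj) _ _

theorem glue_glue_comm {k l : ℕ} (h : k ≤ l) (a b c : MultiIndex n) :
    glue l (glue k a b) c = glue k a (glue l b c) := by
  funext j
  simp only [glue]
  split_ifs <;> first | rfl | omega

/-- Nested pivots for the ranks `R`: at every level `k` there are `R k` row pivots, of which only
the first `k` entries matter, and `R k` column pivots, of which only the other entries matter.
The first `k` entries of a row pivot of level `k + 1` are those of a row pivot of level `k`, and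
column pivots are nested in the opposite direction. -/
structure NestedPivots (n : Fin d → ℕ) (R : ℕ → ℕ) where
  /-- The row pivots of a level. -/
  row : ∀ k, Fin (R k) → MultiIndex n
  /-- The column pivots of a level. -/
  col : ∀ k, Fin (R k) → MultiIndex n
  row_nested : ∀ k, k + 1 < d → ∀ s, ∃ s', ∀ j : Fin d, (j : ℕ) < k → row (k + 1) s j = row k s' j
  col_nested : ∀ k, 0 < k → k < d → ∀ t, ∃ t', ∀ j : Fin d, k + 1 ≤ (j : ℕ) →
    col k t j = col (k + 1) t' j

namespace NestedPivots

variable {R : ℕ → ℕ} (p : NestedPivots n R)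

/-- The multi-indices that extend a row pivot of level `k`. -/
def left (k : ℕ) : Set (MultiIndex n) :=
  {i | ∃ s, ∀ j : Fin d, (j : ℕ) < k → i j = p.row k s j}

/-- The multi-indices that extend a column pivot of level `k`. -/
def right (k : ℕ) : Set (MultiIndex n) :=
  {i | ∃ t, ∀ j : Fin d, k ≤ (j : ℕ) → i j = p.col k t j}

/-- The free entries: those with a row pivot before some mode and a column pivot behind it. -/
def support : Set (MultiIndex n) := {i | ∃ m < d, i ∈ p.left m ∧ i ∈ p.right (m + 1)}

theorem left_anti {k l : ℕ} (hkl : k ≤ l) (hl : l < d) : p.left l ⊆ p.left k := by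
  induction l, hkl using Nat.le_induction with
  | base => exact subset_rfl
  | succ l hkl ih =>
    refine Set.Subset.trans ?_ (ih (by omega))
    rintro i ⟨s, hs⟩
    obtain ⟨s', hs'⟩ := p.row_nested l hl s
    exact ⟨s', fun j hj => (hs j (by omega)).trans (hs' j hj)⟩

theorem right_mono {k l : ℕ} (hk : 0 < k) (hkl : k ≤ l) (hl : l ≤ d) : p.right k ⊆ p.right l := by
  induction l, hkl using Nat.le_induction with
  | base => exact subset_rfl
  | succ l hkl ih =>
    refine Set.Subset.trans (ih (by omega)) ?_
    rintro i ⟨t, ht⟩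
    obtain ⟨t', ht'⟩ := p.col_nested l (by omega) hl t
    exact ⟨t', fun j hj => (ht j (by omega)).trans (ht' j hj)⟩

theorem left_zero (h0 : R 0 = 1) : p.left 0 = Set.univ :=
  Set.eq_univ_of_forall fun _ => ⟨⟨0, by omega⟩, fun _ h => absurd h (Nat.not_lt_zero _)⟩

theorem right_last (hd : R d = 1) : p.right d = Set.univ :=
  Set.eq_univ_of_forall fun _ => ⟨⟨0, by omega⟩, fun j h => absurd j.2 (by omega)⟩

theorem glue_row_mem_left (k : ℕ) (s : Fin (R k)) (i : MultiIndex n) :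
    glue k (p.row k s) i ∈ p.left k := ⟨s, fun _ h => glue_of_lt h _ _⟩

theorem glue_col_mem_right (k : ℕ) (t : Fin (R k)) (i : MultiIndex n) :
    glue k i (p.col k t) ∈ p.right k := ⟨t, fun _ h => glue_of_le h _ _⟩

/-- The levels `m` at which a multi-index lies in `left m ∩ right (m + 1)` form an interval, and the
inner levels `k` at which it lies in `left k ∩ right k` separate its consecutive elements; so, if
there are any, there is one more of the former than of the latter. -/
theorem sum_ite_sub_sum_ite (i : MultiIndex n) [∀ k, Decidable (i ∈ p.left k)]
    [∀ k, Decidable (i ∈ p.right k)]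
    (q : ℕ) (hq0 : 1 ≤ q) (hq : q ≤ d) :
    (∑ m ∈ Finset.range q, if i ∈ p.left m ∧ i ∈ p.right (m + 1) then (1 : ℤ) else 0) -
      (∑ k ∈ Finset.Ico 1 q, if i ∈ p.left k ∧ i ∈ p.right k then (1 : ℤ) else 0) =
    if ∃ m < q, i ∈ p.left m ∧ i ∈ p.right (m + 1) then 1 else 0 := by
  induction q, hq0 using Nat.le_induction with
  | base =>
    rw [Finset.sum_range_one]
    simp
  | succ q hq0 ih =>
    have ih := ih (by omega)
    rw [Finset.sum_range_succ, Finset.sum_Ico_succ_top hq0]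
    have hex : (∃ m < q + 1, i ∈ p.left m ∧ i ∈ p.right (m + 1)) ↔
        (∃ m < q, i ∈ p.left m ∧ i ∈ p.right (m + 1)) ∨ (i ∈ p.left q ∧ i ∈ p.right (q + 1)) := by
      constructor
      · rintro ⟨m, hm, h⟩
        rcases Nat.lt_succ_iff_lt_or_eq.1 hm with h' | rfl
        exacts [Or.inl ⟨m, h', h⟩, Or.inr h]
      · rintro (⟨m, hm, h⟩ | h)
        exacts [⟨m, by omega, h⟩, ⟨q, by omega, h⟩]
    by_cases ha : i ∈ p.left q
    · by_cases hb : i ∈ p.right q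
      · have h1 : ∃ m < q, i ∈ p.left m ∧ i ∈ p.right (m + 1) :=
          ⟨q - 1, by omega, p.left_anti (by omega) (by omega) ha, by
            rwa [Nat.sub_add_cancel hq0]⟩
        have h2 : i ∈ p.right (q + 1) := p.right_mono (by omega) (by omega) hq hb
        rw [if_pos h1] at ih
        rw [if_pos (hex.2 (Or.inl h1)), if_pos ⟨ha, h2⟩, if_pos ⟨ha, hb⟩]
        linarith
      · have h1 : ¬ ∃ m < q, i ∈ p.left m ∧ i ∈ p.right (m + 1) := fun ⟨m, hm, _, h⟩ =>
          hb (p.right_mono (by omega) hm (by omega) h)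
        rw [if_neg h1] at ih
        simp only [hex, h1, ha, hb, and_false, true_and, false_or, if_false]
        linarith
    · simp only [hex, ha, false_and, or_false, if_false]
      linarith

/-- Row pivots of a level are distinct as prefixes. -/
def RowsDistinct (k : ℕ) : Prop :=
  ∀ s s', (∀ j : Fin d, (j : ℕ) < k → p.row k s j = p.row k s' j) → s = s'

/-- Column pivots of a level are distinct as suffixes. -/
def ColsDistinct (k : ℕ) : Prop :=
  ∀ t t', (∀ j : Fin d, k ≤ (j : ℕ) → p.col k t j = p.col k t' j) → t = t'

theorem card_left_inter_right {k : ℕ} (hr : p.RowsDistinct k) (hc : p.ColsDistinct k)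
    [DecidablePred (· ∈ p.left k)] [DecidablePred (· ∈ p.right k)] :
    (Finset.univ.filter fun i => i ∈ p.left k ∧ i ∈ p.right k).card = R k ^ 2 := by
  have h : (Finset.univ : Finset (Fin (R k) × Fin (R k))).card = R k ^ 2 := by simp [sq]
  rw [← h]
  symm
  refine Finset.card_bij (fun x _ => glue k (p.row k x.1) (p.col k x.2)) ?_ ?_ ?_
  · intro x _
    simp [p.glue_row_mem_left, p.glue_col_mem_right]
  · rintro ⟨s, t⟩ _ ⟨s', t'⟩ _ h
    refine Prod.ext (hr _ _ fun j hj => ?_) (hc _ _ fun j hj => ?_)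
    · simpa [glue_of_lt hj] using congrFun h j
    · simpa [glue_of_le hj] using congrFun h j
  · intro i hi
    obtain ⟨⟨s, hs⟩, t, ht⟩ := (Finset.mem_filter.1 hi).2
    refine ⟨(s, t), Finset.mem_univ _, ?_⟩
    rw [← glue_self k i]
    exact glue_congr (fun j hj => (hs j hj).symm) fun j hj => (ht j hj).symm

theorem card_left_inter_right_succ (m : Fin d) (hr : p.RowsDistinct m)
    (hc : p.ColsDistinct (m + 1))
    [DecidablePred (· ∈ p.left m)] [DecidablePred (· ∈ p.right (m + 1))] :
    (Finset.univ.filter fun i => i ∈ p.left m ∧ i ∈ p.right (m + 1)).card =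
      R m * n m * R (m + 1) := by
  have h : (Finset.univ : Finset ((Fin (R m) × Fin (n m)) × Fin (R (m + 1)))).card =
    R m * n m * R (m + 1) := by simp
  rw [← h]
  symm
  refine Finset.card_bij (fun x _ =>
    Function.update (glue m (p.row m x.1.1) (p.col (m + 1) x.2)) m x.1.2) ?_ ?_ ?_
  · intro x _
    refine Finset.mem_filter.2 ⟨Finset.mem_univ _, ⟨x.1.1, fun j hj => ?_⟩, x.2, fun j hj => ?_⟩
    · rw [Function.update_of_ne (by rintro rfl; omega), glue_of_lt hj]
    · rw [Function.update_of_ne (by rintro rfl; omega), glue_of_le (by omega)]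
  · rintro ⟨⟨s, c⟩, t⟩ _ ⟨⟨s', c'⟩, t'⟩ _ h
    refine Prod.ext (Prod.ext (hr _ _ fun j hj => ?_) ?_) (hc _ _ fun j hj => ?_)
    · have := congrFun h j
      simpa [Function.update_of_ne (show j ≠ m by rintro rfl; omega), glue_of_lt hj] using this
    · simpa using congrFun h m
    · have := congrFun h j
      simpa [Function.update_of_ne (show j ≠ m by rintro rfl; omega),
        glue_of_le (show (m : ℕ) ≤ j by omega)] using this
  · intro i hi
    obtain ⟨⟨s, hs⟩, t, ht⟩ := (Finset.mem_filter.1 hi).2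
    refine ⟨((s, i m), t), Finset.mem_univ _, funext fun j => ?_⟩
    rcases lt_trichotomy (j : ℕ) m with hj | hj | hj
    · rw [Function.update_of_ne (by rintro rfl; omega), glue_of_lt hj, hs j hj]
    · obtain rfl := Fin.ext hj
      simp
    · rw [Function.update_of_ne (by rintro rfl; omega), glue_of_le (by omega), ht j hj]

/-- The number of free entries. -/
theorem card_support (hd : 1 ≤ d) (hr : ∀ k < d, p.RowsDistinct k)
    (hc : ∀ k, 0 < k → k ≤ d → p.ColsDistinct k) [DecidablePred (· ∈ p.support)] :
    (Fintype.card {i // i ∈ p.support} : ℤ) =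
      ∑ m : Fin d, (R m : ℤ) * (n m : ℤ) * (R (m + 1) : ℤ) -
        ∑ k ∈ Finset.Ico 1 d, (R k : ℤ) ^ 2 := by
  classical
  rw [Fintype.card_subtype, Finset.card_filter]
  push_cast
  have hi : ∀ i : MultiIndex n, (if i ∈ p.support then (1 : ℤ) else 0) =
      (∑ m ∈ Finset.range d, if i ∈ p.left m ∧ i ∈ p.right (m + 1) then (1 : ℤ) else 0) -
        ∑ k ∈ Finset.Ico 1 d, if i ∈ p.left k ∧ i ∈ p.right k then (1 : ℤ) else 0 := fun i => by
    rw [p.sum_ite_sub_sum_ite i d hd le_rfl]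
    exact if_congr Iff.rfl rfl rfl
  rw [Finset.sum_congr rfl fun i _ => hi i, Finset.sum_sub_distrib, Finset.sum_comm]
  congr 1
  · rw [Finset.sum_range]
    refine Finset.sum_congr rfl fun m _ => ?_
    rw [← Nat.cast_mul, ← Nat.cast_mul, ← p.card_left_inter_right_succ m (hr m m.2)
      (hc _ (by omega) (by omega)), Finset.card_filter]
    push_cast
    rfl
  · rw [Finset.sum_comm]
    refine Finset.sum_congr rfl fun k hk => ?_
    have hk := Finset.mem_Ico.1 hk
    rw [← Nat.cast_pow, ← p.card_left_inter_right (hr k hk.2) (hc k (by omega) (by omega)),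
      Finset.card_filter]
    push_cast
    rfl

end NestedPivots

/-! ### Skeleton decompositions of matrices -/

/-- If some `r` rows span the row space of a matrix of rank `r`, and some `r` columns its column
space, then these rows and columns meet in an invertible matrix. -/
theorem Matrix.det_submatrix_ne_zero_of_span {K m m' : Type*} [Field K] [Fintype m] [Fintype m']
    {r : ℕ} (M : Matrix m m' K) (hM : M.rank = r) (f : Fin r → m) (g : Fin r → m')
    (hf : ∀ a, M.row a ∈ Submodule.span K (Set.range (M.row ∘ f)))
    (hg : ∀ b, M.col b ∈ Submodule.span K (Set.range (M.col ∘ g))) :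
    (M.submatrix f g).det ≠ 0 := by
  have hC : ∀ a, ∃ c : Fin r → K, ∑ s, c s • M.row (f s) = M.row a := fun a =>
    (Submodule.mem_span_range_iff_exists_fun K).1 (hf a)
  have hD : ∀ b, ∃ c : Fin r → K, ∑ t, c t • M.col (g t) = M.col b := fun b =>
    (Submodule.mem_span_range_iff_exists_fun K).1 (hg b)
  choose C hC using hC
  choose D hD using hD
  have hfac : M = Matrix.of C * (M.submatrix f g * (Matrix.of D).transpose) := by
    ext a b
    have h1 := congrFun (hC a) b
    simp only [Finset.sum_apply, Pi.smul_apply, smul_eq_mul, Matrix.row_apply] at h1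
    rw [← h1, Matrix.mul_apply]
    refine Finset.sum_congr rfl fun s _ => ?_
    have h2 := congrFun (hD b) (f s)
    simp only [Finset.sum_apply, Pi.smul_apply, smul_eq_mul, Matrix.col_apply] at h2
    rw [← h2, Matrix.mul_apply, Matrix.of_apply]
    exact congrArg _ (Finset.sum_congr rfl fun t _ => mul_comm _ _)
  have hrank : r ≤ (M.submatrix f g).rank := by
    calc r = M.rank := hM.symm
      _ = (Matrix.of C * (M.submatrix f g * (Matrix.of D).transpose)).rank := by rw [← hfac]
      _ ≤ _ := (Matrix.rank_mul_le_right _ _).trans (Matrix.rank_mul_le_left _ _)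
  have hunit : IsUnit (M.submatrix f g) := by
    rw [← Matrix.linearIndependent_rows_iff_isUnit, linearIndependent_iff_card_eq_finrank_span,
      Set.finrank, ← Matrix.rank_eq_finrank_span_row, Fintype.card_fin]
    exact le_antisymm hrank (by simpa using Matrix.rank_le_width (M.submatrix f g))
  exact ((Matrix.isUnit_iff_isUnit_det _).1 hunit).ne_zero

/-- A matrix of rank at most `r` is recovered from `r` of its rows and `r` of its columns that
meet in an invertible matrix. -/
theorem Matrix.eq_skeleton_of_rank_le {K m m' : Type*} [Field K] [Fintype m] [Fintype m']
    {r : ℕ} (M : Matrix m m' K) (hM : M.rank ≤ r) (f : Fin r → m) (g : Fin r → m')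
    (h : (M.submatrix f g).det ≠ 0) :
    M = M.submatrix id g * (M.submatrix f g)⁻¹ * M.submatrix f id := by
  have hdet : IsUnit (M.submatrix f g).det := isUnit_iff_ne_zero.2 h
  have hli : LinearIndependent K (M.row ∘ f) := by
    have h1 : LinearIndependent K (M.submatrix f g).row :=
      Matrix.linearIndependent_rows_iff_isUnit.2 ((Matrix.isUnit_iff_isUnit_det _).2 hdet)
    exact LinearIndependent.of_comp (LinearMap.funLeft K K g) h1
  have hspan : Submodule.span K (Set.range (M.row ∘ f)) = Submodule.span K (Set.range M.row) := by
    refine Submodule.eq_of_le_of_finrank_le (Submodule.span_mono (Set.range_comp_subset_range _ _))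
      ?_
    rw [← Matrix.rank_eq_finrank_span_row, finrank_span_eq_card hli, Fintype.card_fin]
    exact hM
  have hC : ∀ a, ∃ c : Fin r → K, ∑ s, c s • M.row (f s) = M.row a := fun a =>
    (Submodule.mem_span_range_iff_exists_fun K).1 <| by
      have := hspan ▸ Submodule.subset_span (Set.mem_range_self a)
      exact this
  choose C hC using hC
  have hfac : M = Matrix.of C * M.submatrix f id := by
    ext a b
    have h1 := congrFun (hC a) b
    simp only [Finset.sum_apply, Pi.smul_apply, smul_eq_mul, Matrix.row_apply] at h1
    rw [← h1, Matrix.mul_apply]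
    rfl
  have hcol : M.submatrix id g = Matrix.of C * M.submatrix f g := by
    conv_lhs => rw [hfac]
    ext a b
    simp [Matrix.mul_apply]
  rw [hcol, Matrix.mul_nonsing_inv_cancel_right _ _ hdet, ← hfac]

/-! ### Unfoldings indexed by full multi-indices -/

/-- The `k`-th unfolding with rows and columns indexed by full multi-indices; the row of `a`
depends on the first `k` entries of `a` only, and the column of `b` on the other entries of `b`. -/
def flat (k : ℕ) (y : CTensor n) : Matrix (MultiIndex n) (MultiIndex n) ℂ :=
  Matrix.of fun a b => y (glue k a b)

theorem flat_apply (k : ℕ) (y : CTensor n) (a b : MultiIndex n) : flat k y a b = y (glue k a b) :=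
  rfl

theorem rank_flat [Nonempty (MultiIndex n)] (k : ℕ) (y : CTensor n) :
    (flat k y).rank = (y.unfolding k).rank := by
  obtain ⟨i₀⟩ := ‹Nonempty (MultiIndex n)›
  refine le_antisymm ?_ ?_
  · have h : flat k y = (y.unfolding k).submatrix (fun a j => a j.1) (fun b j => b j.1) := by
      ext a b
      rw [flat_apply, Matrix.submatrix_apply, CTensor.unfolding, Matrix.of_apply]
      refine congrArg (fun i => y i) (funext fun j => ?_)
      by_cases hj : (j : ℕ) < k <;> simp [glue, hj]
    rw [h]
    exact Matrix.rank_submatrix_le _ _ _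
  · have h : y.unfolding k = (flat k y).submatrix
        (fun a j => if h : (j : ℕ) < k then a ⟨j, h⟩ else i₀ j)
        (fun b j => if h : ¬ (j : ℕ) < k then b ⟨j, h⟩ else i₀ j) := by
      ext a b
      rw [Matrix.submatrix_apply, flat_apply, CTensor.unfolding, Matrix.of_apply]
      refine congrArg (fun i => y i) (funext fun j => ?_)
      by_cases hj : (j : ℕ) < k <;> simp [glue, hj]
    rw [h]
    exact Matrix.rank_submatrix_le _ _ _

namespace NestedPivots

variable {R : ℕ → ℕ} (p : NestedPivots n R)

/-- The matrix in which the pivot rows and pivot columns of level `k` meet. -/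
def pivotMatrix (k : ℕ) (y : CTensor n) : Matrix (Fin (R k)) (Fin (R k)) ℂ :=
  (flat k y).submatrix (p.row k) (p.col k)

/-- The tensors whose pivot matrices at the inner levels are invertible. -/
def domain : Set (CTensor n) := {y | ∀ k ∈ Finset.Ioo 0 d, (p.pivotMatrix k y).det ≠ 0}

/-- The tensor whose `k`-th unfolding is built from the pivot rows and pivot columns of the `k`-th
unfolding of `y`. It is meaningful only where the pivot matrix is invertible. -/
noncomputable def cross (k : ℕ) (y : CTensor n) : CTensor n :=
  WithLp.toLp 2 fun i => ((flat k y).submatrix id (p.col k) * (p.pivotMatrix k y)⁻¹ *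
    (flat k y).submatrix (p.row k) id) i i

theorem cross_apply (k : ℕ) (y : CTensor n) (i : MultiIndex n) : p.cross k y i =
    ((flat k y).submatrix id (p.col k) * (p.pivotMatrix k y)⁻¹ *
      (flat k y).submatrix (p.row k) id) i i := rfl

theorem flat_cross (k : ℕ) (y : CTensor n) : flat k (p.cross k y) =
    (flat k y).submatrix id (p.col k) * (p.pivotMatrix k y)⁻¹ *
      (flat k y).submatrix (p.row k) id := by
  ext a b
  rw [flat_apply, cross_apply]
  simp only [Matrix.mul_apply, Matrix.submatrix_apply, id_eq, flat_apply, glue_glue_left,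
    glue_glue_right]

theorem rank_flat_cross_le (k : ℕ) (y : CTensor n) : (flat k (p.cross k y)).rank ≤ R k := by
  rw [flat_cross]
  refine (Matrix.rank_mul_le_right _ _).trans ?_
  simpa using Matrix.rank_le_card_height ((flat k y).submatrix (p.row k) id)

theorem cross_eq_self {k : ℕ} {y : CTensor n} (hdet : (p.pivotMatrix k y).det ≠ 0)
    (hrank : (flat k y).rank ≤ R k) : p.cross k y = y := by
  ext i
  rw [cross_apply, pivotMatrix, ← Matrix.eq_skeleton_of_rank_le (flat k y) hrank _ _ hdet,
    flat_apply, glue_self]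

theorem cross_apply_of_mem_left {k : ℕ} {y : CTensor n} (hdet : (p.pivotMatrix k y).det ≠ 0)
    {i : MultiIndex n} (hi : i ∈ p.left k) : p.cross k y i = y i := by
  obtain ⟨s, hs⟩ := hi
  have hrow : ∀ b, glue k i b = glue k (p.row k s) b := fun b => glue_congr hs fun _ _ => rfl
  have h : (p.pivotMatrix k y * (p.pivotMatrix k y)⁻¹ * (flat k y).submatrix (p.row k) id) s i =
      y i := by
    rw [Matrix.mul_nonsing_inv _ (isUnit_iff_ne_zero.2 hdet), Matrix.one_mul,
      Matrix.submatrix_apply, flat_apply, id_eq, ← hrow, glue_self]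
  rw [← h, cross_apply]
  simp only [Matrix.mul_apply, Matrix.submatrix_apply, id_eq, flat_apply, hrow, pivotMatrix]

theorem cross_apply_of_mem_right {k : ℕ} {y : CTensor n} (hdet : (p.pivotMatrix k y).det ≠ 0)
    {i : MultiIndex n} (hi : i ∈ p.right k) : p.cross k y i = y i := by
  obtain ⟨t, ht⟩ := hi
  have hcol : ∀ a, glue k a i = glue k a (p.col k t) := fun a => glue_congr (fun _ _ => rfl) ht
  have h : ((flat k y).submatrix id (p.col k) * ((p.pivotMatrix k y)⁻¹ * p.pivotMatrix k y)) i t =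
      y i := by
    rw [Matrix.nonsing_inv_mul _ (isUnit_iff_ne_zero.2 hdet), Matrix.mul_one,
      Matrix.submatrix_apply, flat_apply, id_eq, ← hcol, glue_self]
  rw [← h, cross_apply, Matrix.mul_assoc]
  simp only [Matrix.mul_apply, Matrix.submatrix_apply, id_eq, flat_apply, hcol, pivotMatrix]

/-- An index that starts with a row pivot and ends with a column pivot, with at most one mode in
between, meets a pivot row or a pivot column at every inner level. -/
theorem mem_left_or_mem_right {k : ℕ} (hkd : k < d) {m l : ℕ} (hm : m < d)
    (hl0 : 0 < l) (hml : l ≤ m + 1) {i : MultiIndex n} (hi : i ∈ p.left m) (hi' : i ∈ p.right l) :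
    i ∈ p.left k ∨ i ∈ p.right k := by
  rcases le_or_gt k m with h | h
  · exact Or.inl (p.left_anti h hm hi)
  · exact Or.inr (p.right_mono hl0 (by omega) hkd.le hi')

theorem cross_apply_of_mem_support {k : ℕ} (hkd : k < d) {y : CTensor n}
    (hdet : (p.pivotMatrix k y).det ≠ 0) {i : MultiIndex n} (hi : i ∈ p.support) :
    p.cross k y i = y i := by
  obtain ⟨m, hm, h1, h2⟩ := hi
  rcases p.mem_left_or_mem_right hkd hm (Nat.succ_pos _) le_rfl h1 h2 with h | h
  exacts [p.cross_apply_of_mem_left hdet h, p.cross_apply_of_mem_right hdet h]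

theorem pivotMatrix_congr {k : ℕ} (hk0 : 0 < k) (hkd : k < d) {y z : CTensor n}
    (h : ∀ i ∈ p.support, y i = z i) : p.pivotMatrix k y = p.pivotMatrix k z := by
  ext s t
  exact h _ ⟨k, hkd, p.glue_row_mem_left k s _,
    p.right_mono hk0 k.le_succ hkd (p.glue_col_mem_right k t _)⟩

theorem mem_domain_congr {y z : CTensor n} (h : ∀ i ∈ p.support, y i = z i) (hy : y ∈ p.domain) :
    z ∈ p.domain := by
  intro k hk
  obtain ⟨h0, hd⟩ := Finset.mem_Ioo.1 hk
  rw [← p.pivotMatrix_congr h0 hd h]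
  exact hy k hk

/-- Every column of the `k`-th unfolding of `cross l y` is a combination of columns of the `k`-th
unfolding of `y`. -/
theorem rank_flat_cross_le_rank_flat {k l : ℕ} (hkl : k ≤ l) (y : CTensor n) :
    (flat k (p.cross l y)).rank ≤ (flat k y).rank := by
  classical
  -- the skeleton at level `l` only modifies the column index at level `k`
  let W : Matrix (Fin (R l)) (MultiIndex n) ℂ :=
    (p.pivotMatrix l y)⁻¹ * (flat l y).submatrix (p.row l) id
  let Z : Matrix (MultiIndex n) (MultiIndex n) ℂ := Matrix.of fun e b =>
    ∑ s, if glue l b (p.col l s) = e then W s b else 0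
  have hW : ∀ s a b, W s (glue k a b) = W s b := fun s a b => by
    simp only [W, Matrix.mul_apply, Matrix.submatrix_apply, id_eq, flat_apply,
      glue_glue_of_ge hkl]
  have h : flat k (p.cross l y) = flat k y * Z := by
    ext a b
    rw [flat_apply, cross_apply, Matrix.mul_assoc, Matrix.mul_apply, Matrix.mul_apply]
    simp only [Z, Matrix.of_apply, Finset.mul_sum, mul_ite, mul_zero]
    rw [Finset.sum_comm]
    refine Finset.sum_congr rfl fun s _ => ?_
    rw [Finset.sum_ite_eq, if_pos (Finset.mem_univ _), Matrix.submatrix_apply, flat_apply,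
      flat_apply, id_eq, glue_glue_comm hkl, ← hW s a b]
  rw [h]
  exact Matrix.rank_mul_le_left _ _

/-- The successive cross approximation at the levels `1, …, m`. -/
noncomputable def retraction : ℕ → CTensor n → CTensor n
  | 0, y => y
  | m + 1, y => p.cross (m + 1) (retraction m y)

/-- The retraction keeps the free entries and bounds the ranks of the levels treated so far. -/
theorem retraction_spec {m : ℕ} (hm : m < d) {y : CTensor n} (hy : y ∈ p.domain) :
    (∀ i ∈ p.support, p.retraction m y i = y i) ∧
      ∀ k, 0 < k → k ≤ m → (flat k (p.retraction m y)).rank ≤ R k := by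
  induction m with
  | zero => exact ⟨fun _ _ => rfl, fun k h0 h => absurd h (by omega)⟩
  | succ m ih =>
    obtain ⟨hkeep, hrank⟩ := ih (by omega)
    have hmem : p.retraction m y ∈ p.domain :=
      p.mem_domain_congr (fun i hi => (hkeep i hi).symm) hy
    refine ⟨fun i hi => ?_, fun k h0 hk => ?_⟩
    · exact (p.cross_apply_of_mem_support hm
        (hmem _ (Finset.mem_Ioo.2 ⟨m.succ_pos, hm⟩)) hi).trans (hkeep i hi)
    · rcases Nat.le_succ_iff.1 hk with h | rfl
      · exact (p.rank_flat_cross_le_rank_flat hk _).trans (hrank k h0 h)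
      · exact p.rank_flat_cross_le _ _

theorem retraction_mem_domain {m : ℕ} (hm : m < d) {y : CTensor n} (hy : y ∈ p.domain) :
    p.retraction m y ∈ p.domain :=
  p.mem_domain_congr (fun i hi => ((p.retraction_spec hm hy).1 i hi).symm) hy

theorem retraction_eq_self {m : ℕ} (hm : m < d) {y : CTensor n} (hy : y ∈ p.domain)
    (hrank : ∀ k, 0 < k → k < d → (flat k y).rank ≤ R k) : p.retraction m y = y := by
  induction m with
  | zero => rfl
  | succ m ih =>
    rw [retraction, ih (by omega)]
    exact p.cross_eq_self (hy _ (Finset.mem_Ioo.2 ⟨m.succ_pos, hm⟩)) (hrank _ m.succ_pos hm)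

/-- A tensor of the prescribed ranks is determined by its free entries: the skeleton decomposition
at level `k + 1` reduces an entry in `left k` to free entries and to entries in `left (k + 1)`. -/
theorem eq_of_eq_on_support (h0 : R 0 = 1) (hd1 : 1 ≤ d) (hd : R d = 1) {y z : CTensor n}
    (hy : y ∈ p.domain) (hry : ∀ k, 0 < k → k < d → (flat k y).rank ≤ R k)
    (hrz : ∀ k, 0 < k → k < d → (flat k z).rank ≤ R k)
    (h : ∀ i ∈ p.support, y i = z i) : y = z := by
  have hz : z ∈ p.domain := p.mem_domain_congr h hy
  have key : ∀ e k, k + 1 + e = d → ∀ i ∈ p.left k, y i = z i := by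
    intro e
    induction e with
    | zero =>
      intro k hk i hi
      refine h i ⟨k, by omega, hi, ?_⟩
      rw [show k + 1 = d by omega, p.right_last hd]
      trivial
    | succ e ih =>
      intro k hk i hi
      have hk1 : k + 1 ∈ Finset.Ioo 0 d := Finset.mem_Ioo.2 ⟨k.succ_pos, by omega⟩
      have hcol : (flat (k + 1) y).submatrix id (p.col (k + 1)) i =
          (flat (k + 1) z).submatrix id (p.col (k + 1)) i := by
        funext t
        refine h _ ⟨k, by omega, ?_, p.glue_col_mem_right _ _ _⟩
        obtain ⟨s, hs⟩ := hi
        exact ⟨s, fun j hj => (glue_of_lt (hj.trans k.lt_succ_self) _ _).trans (hs j hj)⟩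
      have hrow : (flat (k + 1) y).submatrix (p.row (k + 1)) id =
          (flat (k + 1) z).submatrix (p.row (k + 1)) id := by
        ext s b
        exact ih (k + 1) (by omega) _ (p.glue_row_mem_left _ _ _)
      rw [← p.cross_eq_self (hy _ hk1) (hry _ k.succ_pos (by omega)),
        ← p.cross_eq_self (hz _ hk1) (hrz _ k.succ_pos (by omega)), cross_apply, cross_apply,
        p.pivotMatrix_congr k.succ_pos (by omega) h, hrow, Matrix.mul_apply, Matrix.mul_apply]
      simp only [Matrix.mul_apply, hcol]
  ext i
  exact key (d - 1) 0 (by omega) i (by rw [p.left_zero h0]; trivial)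

theorem retraction_congr (h0 : R 0 = 1) (hd1 : 1 ≤ d) (hd : R d = 1) {y z : CTensor n}
    (hy : y ∈ p.domain) (hz : z ∈ p.domain) (h : ∀ i ∈ p.support, y i = z i) :
    p.retraction (d - 1) y = p.retraction (d - 1) z := by
  have hy' := p.retraction_spec (m := d - 1) (by omega) hy
  have hz' := p.retraction_spec (m := d - 1) (by omega) hz
  refine p.eq_of_eq_on_support h0 hd1 hd (p.retraction_mem_domain (by omega) hy)
    (fun k hk0 hk => hy'.2 k hk0 (by omega)) (fun k hk0 hk => hz'.2 k hk0 (by omega))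
    fun i hi => ?_
  rw [hy'.1 i hi, hz'.1 i hi, h i hi]

theorem rank_flat_eq_of_mem_domain {y : CTensor n} (hy : y ∈ p.domain) {k : ℕ} (hk0 : 0 < k)
    (hkd : k < d) (hrank : (flat k y).rank ≤ R k) : (flat k y).rank = R k := by
  refine le_antisymm hrank ?_
  have h := Matrix.rank_of_det_ne_zero (hy k (Finset.mem_Ioo.2 ⟨hk0, hkd⟩))
  rw [Fintype.card_fin] at h
  exact h.symm.le.trans (Matrix.rank_submatrix_le _ _ _)

theorem retraction_eq_self_iff (hd1 : 1 ≤ d) {y : CTensor n} (hy : y ∈ p.domain) :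
    p.retraction (d - 1) y = y ↔ ∀ k, 0 < k → k < d → (flat k y).rank = R k := by
  constructor
  · intro h k hk0 hk
    refine p.rank_flat_eq_of_mem_domain hy hk0 hk ?_
    have := (p.retraction_spec (m := d - 1) (by omega) hy).2 k hk0 (by omega)
    rwa [h] at this
  · exact fun h => p.retraction_eq_self (by omega) hy fun k hk0 hk => (h k hk0 hk).le

/-! ### Smoothness of the retraction -/

theorem contDiff_entry (i : MultiIndex n) : ContDiff ℂ ∞ fun y : CTensor n => y i :=
  contDiff_piLp_apply 2

theorem contDiffOn_det {ι E : Type*} [Fintype ι] [DecidableEq ι] [NormedAddCommGroup E]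
    [NormedSpace ℂ E] {U : Set E} {A : E → Matrix ι ι ℂ}
    (hA : ∀ s t, ContDiffOn ℂ ∞ (fun y => A y s t) U) : ContDiffOn ℂ ∞ (fun y => (A y).det) U := by
  simp only [Matrix.det_apply']
  exact ContDiffOn.sum fun σ _ => contDiffOn_const.mul (contDiffOn_prod fun s _ => hA _ _)

theorem contDiffOn_inv_apply {ι E : Type*} [Fintype ι] [DecidableEq ι] [NormedAddCommGroup E]
    [NormedSpace ℂ E] {U : Set E} {A : E → Matrix ι ι ℂ}
    (hA : ∀ s t, ContDiffOn ℂ ∞ (fun y => A y s t) U) (hdet : ∀ y ∈ U, (A y).det ≠ 0) (s t : ι) :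
    ContDiffOn ℂ ∞ (fun y => (A y)⁻¹ s t) U := by
  simp only [Matrix.inv_def, Ring.inverse_eq_inv', Matrix.smul_apply, smul_eq_mul,
    Matrix.adjugate_apply]
  refine ((contDiffOn_det hA).inv hdet).mul (contDiffOn_det fun i j => ?_)
  by_cases hi : i = t
  · subst hi
    simpa using contDiffOn_const
  · simpa [Matrix.updateRow_ne hi] using hA i j

theorem contDiffOn_cross {k : ℕ} (hk : k ∈ Finset.Ioo 0 d) :
    ContDiffOn ℂ ∞ (p.cross k) p.domain := by
  refine contDiffOn_euclidean.2 fun i => ?_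
  simp only [cross_apply, Matrix.mul_apply]
  refine ContDiffOn.sum fun t _ => (ContDiffOn.sum fun s _ => ?_).mul ?_
  · exact (contDiff_entry _).contDiffOn.mul
      (contDiffOn_inv_apply (fun _ _ => (contDiff_entry _).contDiffOn) (U := p.domain)
        (fun _ hy => hy k hk) _ _)
  · exact (contDiff_entry _).contDiffOn

theorem contDiffOn_retraction {m : ℕ} (hm : m < d) :
    ContDiffOn ℂ ∞ (p.retraction m) p.domain := by
  induction m with
  | zero => exact contDiffOn_id
  | succ m ih =>
    exact (p.contDiffOn_cross (Finset.mem_Ioo.2 ⟨m.succ_pos, hm⟩)).comp (ih (by omega))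
      fun y hy => p.retraction_mem_domain (by omega) hy

theorem isOpen_domain : IsOpen p.domain := by
  have h : p.domain = ⋂ k ∈ Finset.Ioo 0 d, {y | (p.pivotMatrix k y).det ≠ 0} := by
    ext y; simp [domain]
  rw [h]
  refine isOpen_biInter_finset fun k _ => isOpen_ne_fun ?_ continuous_const
  exact (contDiffOn_univ.1 (contDiffOn_det fun _ _ => (contDiff_entry _).contDiffOn)).continuous

end NestedPivots

/-! ### Existence of nested pivots -/

/-- Dependent choice along `0, …, N`. -/
theorem exists_dependent_seq_up {β : ℕ → Type*} [∀ k, Nonempty (β k)] (N : ℕ)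
    {P : ∀ k, β k → Prop} {Q : ∀ k, β k → β (k + 1) → Prop} (h0 : ∃ x, P 0 x)
    (hs : ∀ k < N, ∀ x, P k x → ∃ y, P (k + 1) y ∧ Q k x y) :
    ∃ f : ∀ k, β k, (∀ k ≤ N, P k (f k)) ∧ ∀ k < N, Q k (f k) (f (k + 1)) := by
  induction N with
  | zero =>
    obtain ⟨x, hx⟩ := h0
    refine ⟨Function.update (fun k => Classical.arbitrary (β k)) 0 x, fun k hk => ?_,
      fun k hk => absurd hk (Nat.not_lt_zero k)⟩
    obtain rfl := Nat.le_zero.1 hk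
    simpa using hx
  | succ N ih =>
    obtain ⟨f, hP, hQ⟩ := ih fun k hk => hs k (by omega)
    obtain ⟨y, hy, hxy⟩ := hs N N.lt_succ_self _ (hP N le_rfl)
    have hne : ∀ k ≤ N, Function.update f (N + 1) y k = f k := fun k hk =>
      Function.update_of_ne (by omega) _ _
    refine ⟨Function.update f (N + 1) y, fun k hk => ?_, fun k hk => ?_⟩
    · rcases Nat.le_succ_iff.1 hk with h | rfl
      · rw [hne k h]; exact hP k h
      · simpa using hy
    · rcases Nat.lt_succ_iff_lt_or_eq.1 hk with h | rfl
      · rw [hne k (by omega), hne (k + 1) h]; exact hQ k h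
      · rw [hne k le_rfl]; simpa using hxy

/-- Dependent choice along `N, …, 0`. -/
theorem exists_dependent_seq_down {β : ℕ → Type*} [∀ k, Nonempty (β k)] (N : ℕ)
    {P : ∀ k, β k → Prop} {Q : ∀ k, β k → β (k + 1) → Prop} (x : β N) (hN : P N x)
    (hs : ∀ k < N, ∀ y, P (k + 1) y → ∃ x, P k x ∧ Q k x y) :
    ∃ f : ∀ k, β k, f N = x ∧ (∀ k ≤ N, P k (f k)) ∧ ∀ k < N, Q k (f k) (f (k + 1)) := by
  induction N with
  | zero =>
    refine ⟨Function.update (fun k => Classical.arbitrary (β k)) 0 x, by simp, fun k hk => ?_,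
      fun k hk => absurd hk (Nat.not_lt_zero k)⟩
    obtain rfl := Nat.le_zero.1 hk
    simpa using hN
  | succ N ih =>
    obtain ⟨z, hz, hzx⟩ := hs N N.lt_succ_self x hN
    obtain ⟨f, hfN, hP, hQ⟩ := ih z hz fun k hk => hs k (by omega)
    have hne : ∀ k ≤ N, Function.update f (N + 1) x k = f k := fun k hk =>
      Function.update_of_ne (by omega) _ _
    refine ⟨Function.update f (N + 1) x, by simp, fun k hk => ?_, fun k hk => ?_⟩
    · rcases Nat.le_succ_iff.1 hk with h | rfl
      · rw [hne k h]; exact hP k h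
      · simpa using hN
    · rcases Nat.lt_succ_iff_lt_or_eq.1 hk with h | rfl
      · rw [hne k (by omega), hne (k + 1) h]; exact hQ k h
      · rw [hne k le_rfl, hfN]; simpa using hzx

/-- From a family `v ∘ u` whose span contains the family `v` one can select a basis of the span of
`v`. -/
theorem exists_basis_of_span {K V α ι : Type*} [Field K] [AddCommGroup V] [Module K V]
    [FiniteDimensional K V] (v : α → V) (u : ι → α) {r : ℕ}
    (hr : Module.finrank K (Submodule.span K (Set.range v)) = r)
    (hu : ∀ a, v a ∈ Submodule.span K (Set.range (v ∘ u))) :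
    ∃ f : Fin r → ι, ∀ a, v a ∈ Submodule.span K (Set.range (v ∘ u ∘ f)) := by
  obtain ⟨κ, a, -, hspan, hli⟩ := exists_linearIndependent' K (v ∘ u)
  have hle : Submodule.span K (Set.range v) = Submodule.span K (Set.range (v ∘ u)) :=
    le_antisymm (Submodule.span_le.2 (by rintro _ ⟨b, rfl⟩; exact hu b))
      (Submodule.span_mono (Set.range_comp_subset_range _ _))
  have := hli.finite
  have := Fintype.ofFinite κ
  have hcard : Fintype.card κ = r := by
    rw [← hr, hle, ← hspan, finrank_span_eq_card hli]
  let e : Fin r ≃ κ := (finCongr hcard.symm).trans (Fintype.equivFin κ).symm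
  refine ⟨a ∘ e, fun b => ?_⟩
  have h : Set.range (v ∘ u ∘ a ∘ e) = Set.range ((v ∘ u) ∘ a) :=
    e.surjective.range_comp ((v ∘ u) ∘ a)
  rw [h, hspan]
  exact hu b

/-- If `v' a` is the image of `v a` under a linear map that depends on the label `c a` only, then the
elements `f s`, relabelled in all possible ways by `g`, span all values of `v'`. -/
theorem mem_span_of_linear_transport {K V V' α ι γ : Type*} [Field K] [AddCommGroup V] [Module K V]
    [AddCommGroup V'] [Module K V'] (v : α → V) (v' : α → V') (f : ι → α) (T : γ → V →ₗ[K] V')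
    (g : α → γ → α) (c : α → γ) (hc : ∀ a, v' a = T (c a) (v a))
    (hg : ∀ a x, v' (g a x) = T x (v a)) (hf : ∀ a, v a ∈ Submodule.span K (Set.range (v ∘ f)))
    (a : α) :
    v' a ∈ Submodule.span K (Set.range (v' ∘ fun q : ι × γ => g (f q.1) q.2)) := by
  rw [hc a]
  have h := Submodule.mem_map_of_mem (f := T (c a)) (hf a)
  rw [Submodule.map_span] at h
  refine Submodule.span_mono ?_ h
  rintro _ ⟨_, ⟨s, rfl⟩, rfl⟩
  exact ⟨(s, c a), hg (f s) (c a)⟩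

/-- Overwriting the entry of one mode in the argument of a function of multi-indices. -/
def overwrite (k : Fin d) (c : Fin (n k)) : (MultiIndex n → ℂ) →ₗ[ℂ] (MultiIndex n → ℂ) :=
  LinearMap.funLeft ℂ ℂ fun b => Function.update b k c

theorem row_flat_succ (X : CTensor n) (k : Fin d) (a : MultiIndex n) :
    (flat (k + 1) X).row a = overwrite k (a k) ((flat k X).row a) := by
  funext b
  refine congrArg (fun i => X i) (funext fun j => ?_)
  change glue (k + 1) a b j = glue k a (Function.update b k (a k)) j
  rcases lt_trichotomy (j : ℕ) k with h | h | h
  · rw [glue_of_lt (by omega), glue_of_lt h]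
  · obtain rfl := Fin.ext h
    rw [glue_of_lt (by omega), glue_of_le le_rfl, Function.update_self]
  · rw [glue_of_le (by omega), glue_of_le h.le, Function.update_of_ne (by rintro rfl; omega)]

theorem row_flat_congr (X : CTensor n) {k : ℕ} {a a' : MultiIndex n}
    (h : ∀ j : Fin d, (j : ℕ) < k → a j = a' j) : (flat k X).row a = (flat k X).row a' :=
  funext fun _ => congrArg (fun i => X i) (glue_congr h fun _ _ => rfl)

theorem col_flat_succ (X : CTensor n) (k : Fin d) (b : MultiIndex n) :
    (flat k X).col b = overwrite k (b k) ((flat (k + 1) X).col b) := by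
  funext a
  refine congrArg (fun i => X i) (funext fun j => ?_)
  change glue k a b j = glue (k + 1) (Function.update a k (b k)) b j
  rcases lt_trichotomy (j : ℕ) k with h | h | h
  · rw [glue_of_lt (by omega), glue_of_lt (by omega), Function.update_of_ne (by rintro rfl; omega)]
  · obtain rfl := Fin.ext h
    rw [glue_of_le le_rfl, glue_of_lt (by omega), Function.update_self]
  · rw [glue_of_le (by omega), glue_of_le (by omega)]

theorem col_flat_congr (X : CTensor n) {k : ℕ} {b b' : MultiIndex n}
    (h : ∀ j : Fin d, k ≤ (j : ℕ) → b j = b' j) : (flat k X).col b = (flat k X).col b' :=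
  funext fun _ => congrArg (fun i => X i) (glue_congr (fun _ _ => rfl) h)

/-- Extending a set of spanning rows of level `k` by all entries of the next mode gives spanning
rows of level `k + 1`, among which a basis can be selected. -/
theorem exists_row_pivots [Nonempty (MultiIndex n)] (X : CTensor n) {R : ℕ → ℕ} (h0 : R 0 = 1)
    (hX : ∀ k, 0 < k → k < d → (flat k X).rank = R k) :
    ∃ f : ∀ k, Fin (R k) → MultiIndex n,
      (∀ k, 0 < k → k < d → ∀ a, (flat k X).row a ∈
        Submodule.span ℂ (Set.range ((flat k X).row ∘ f k))) ∧
      ∀ k, k + 1 < d → ∀ s, ∃ s', ∀ j : Fin d, (j : ℕ) < k → f (k + 1) s j = f k s' j := by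
  have hstep : ∀ k < d - 1, ∀ f : Fin (R k) → MultiIndex n,
      (∀ a, (flat k X).row a ∈ Submodule.span ℂ (Set.range ((flat k X).row ∘ f))) →
      ∃ f' : Fin (R (k + 1)) → MultiIndex n,
        (∀ a, (flat (k + 1) X).row a ∈
          Submodule.span ℂ (Set.range ((flat (k + 1) X).row ∘ f'))) ∧
        ∀ s, ∃ s', ∀ j : Fin d, (j : ℕ) < k → f' s j = f s' j := by
    intro k hk f hf
    let m : Fin d := ⟨k, by omega⟩
    obtain ⟨q, hq⟩ := exists_basis_of_span (K := ℂ) (flat (k + 1) X).row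
      (fun x : Fin (R k) × Fin (n m) => Function.update (f x.1) m x.2) (r := R (k + 1))
      (by rw [← Matrix.rank_eq_finrank_span_row]; exact hX _ k.succ_pos (by omega))
      (mem_span_of_linear_transport (flat k X).row (flat (k + 1) X).row f (overwrite m)
        (fun a c => Function.update a m c) (fun a => a m) (row_flat_succ X m)
        (fun a c => by
          have h := row_flat_succ X m (Function.update a m c)
          rw [Function.update_self] at h
          refine h.trans (congrArg _ (row_flat_congr X fun j hj => ?_))
          exact Function.update_of_ne (by rintro rfl; exact lt_irrefl _ hj) _ _) hf)
    refine ⟨fun s => Function.update (f (q s).1) m (q s).2, hq, fun s => ⟨(q s).1, fun j hj => ?_⟩⟩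
    exact Function.update_of_ne (by rintro rfl; exact lt_irrefl _ hj) _ _
  obtain ⟨f, hP, hQ⟩ := exists_dependent_seq_up (β := fun k => Fin (R k) → MultiIndex n) (d - 1)
    (P := fun k f => ∀ a, (flat k X).row a ∈ Submodule.span ℂ (Set.range ((flat k X).row ∘ f)))
    (Q := fun k f f' => ∀ s, ∃ s', ∀ j : Fin d, (j : ℕ) < k → f' s j = f s' j)
    ⟨fun _ => Classical.arbitrary _, fun a => Submodule.subset_span ⟨⟨0, by omega⟩,
      row_flat_congr X fun _ h => absurd h (Nat.not_lt_zero _)⟩⟩ hstep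
  exact ⟨f, fun k _ hk => hP k (by omega), fun k hk => hQ k (by omega)⟩

/-- The dual of `exists_row_pivots`, descending from level `d`. Level `0` is exempt, because the
rank of the zero tensor there need not be `R 0`. -/
theorem exists_col_pivots [Nonempty (MultiIndex n)] (X : CTensor n) {R : ℕ → ℕ} (hd : R d = 1)
    (hX : ∀ k, 0 < k → k < d → (flat k X).rank = R k) :
    ∃ g : ∀ k, Fin (R k) → MultiIndex n,
      (∀ k, 0 < k → k < d → ∀ b, (flat k X).col b ∈
        Submodule.span ℂ (Set.range ((flat k X).col ∘ g k))) ∧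
      ∀ k, 0 < k → k < d → ∀ t, ∃ t', ∀ j : Fin d, k + 1 ≤ (j : ℕ) →
        g k t j = g (k + 1) t' j := by
  have hstep : ∀ k < d, ∀ g : Fin (R (k + 1)) → MultiIndex n,
      (0 < k + 1 → ∀ b, (flat (k + 1) X).col b ∈
        Submodule.span ℂ (Set.range ((flat (k + 1) X).col ∘ g))) →
      ∃ g' : Fin (R k) → MultiIndex n,
        (0 < k → ∀ b, (flat k X).col b ∈
          Submodule.span ℂ (Set.range ((flat k X).col ∘ g'))) ∧
        (0 < k → ∀ t, ∃ t', ∀ j : Fin d, k + 1 ≤ (j : ℕ) → g' t j = g t' j) := by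
    intro k hk g hg
    rcases Nat.eq_zero_or_pos k with rfl | hk0
    · exact ⟨fun _ => Classical.arbitrary _, fun h => absurd h (lt_irrefl _),
        fun h => absurd h (lt_irrefl _)⟩
    let m : Fin d := ⟨k, hk⟩
    obtain ⟨q, hq⟩ := exists_basis_of_span (K := ℂ) (flat k X).col
      (fun x : Fin (R (k + 1)) × Fin (n m) => Function.update (g x.1) m x.2) (r := R k)
      (by rw [← Matrix.rank_eq_finrank_span_cols]; exact hX _ hk0 hk)
      (mem_span_of_linear_transport (flat (k + 1) X).col (flat k X).col g (overwrite m)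
        (fun a c => Function.update a m c) (fun a => a m) (col_flat_succ X m)
        (fun a c => by
          have h := col_flat_succ X m (Function.update a m c)
          rw [Function.update_self] at h
          refine h.trans (congrArg _ (col_flat_congr X fun j hj => ?_))
          exact Function.update_of_ne (by rintro rfl; simp [m] at hj) _ _) (hg k.succ_pos))
    refine ⟨fun t => Function.update (g (q t).1) m (q t).2, fun _ => hq,
      fun _ t => ⟨(q t).1, fun j hj => ?_⟩⟩
    exact Function.update_of_ne (by rintro rfl; simp [m] at hj) _ _
  obtain ⟨g, -, hP, hQ⟩ := exists_dependent_seq_down (β := fun k => Fin (R k) → MultiIndex n) d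
    (P := fun k g => 0 < k → ∀ b, (flat k X).col b ∈
      Submodule.span ℂ (Set.range ((flat k X).col ∘ g)))
    (Q := fun k g g' => 0 < k → ∀ t, ∃ t', ∀ j : Fin d, k + 1 ≤ (j : ℕ) → g t j = g' t' j)
    (fun _ => Classical.arbitrary _) (fun _ b => Submodule.subset_span ⟨⟨0, by omega⟩,
      col_flat_congr X fun j h => absurd j.2 (by omega)⟩) hstep
  exact ⟨g, fun k h0 hk => hP k hk.le h0, fun k h0 hk => hQ k hk h0⟩

/-- Every tensor of the prescribed ranks lies in the domain of a system of nested pivots. -/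
theorem exists_nestedPivots [Nonempty (MultiIndex n)] (X : CTensor n) {R : ℕ → ℕ} (h0 : R 0 = 1)
    (hd : R d = 1) (hX : ∀ k, 0 < k → k < d → (flat k X).rank = R k) :
    ∃ p : NestedPivots n R, X ∈ p.domain := by
  obtain ⟨f, hf, hf'⟩ := exists_row_pivots X h0 hX
  obtain ⟨g, hg, hg'⟩ := exists_col_pivots X hd hX
  refine ⟨⟨f, g, hf', hg'⟩, fun k hk => ?_⟩
  obtain ⟨hk0, hkd⟩ := Finset.mem_Ioo.1 hk
  exact Matrix.det_submatrix_ne_zero_of_span _ (hX k hk0 hkd) _ _ (hf k hk0 hkd) (hg k hk0 hkd)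

namespace NestedPivots

variable {R : ℕ → ℕ} (p : NestedPivots n R)

theorem rowsDistinct {X : CTensor n} (hX : X ∈ p.domain) (h0 : R 0 = 1) {k : ℕ} (hk : k < d) :
    p.RowsDistinct k := by
  intro s s' h
  rcases Nat.eq_zero_or_pos k with rfl | hk0
  · exact Fin.ext (by omega)
  · by_contra hne
    exact hX k (Finset.mem_Ioo.2 ⟨hk0, hk⟩)
      (Matrix.det_zero_of_row_eq hne (funext fun t => congrFun (row_flat_congr X h) (p.col k t)))

theorem colsDistinct {X : CTensor n} (hX : X ∈ p.domain) (hd : R d = 1) {k : ℕ} (hk0 : 0 < k)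
    (hk : k ≤ d) : p.ColsDistinct k := by
  intro t t' h
  rcases hk.eq_or_lt with rfl | hk
  · exact Fin.ext (by omega)
  · by_contra hne
    exact hX k (Finset.mem_Ioo.2 ⟨hk0, hk⟩)
      (Matrix.det_zero_of_column_eq hne fun s => congrFun (col_flat_congr X h) (p.row k s))

end NestedPivots

end TensorTrain

/-! ### Tensors of fixed TT rank -/

/-- A rank array as a function of all natural numbers, with the junk value `0` beyond `d`. -/
def extendRank {d : ℕ} (r : Fin (d + 1) → ℕ) (k : ℕ) : ℕ :=
  if h : k < d + 1 then r ⟨k, h⟩ else 0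

theorem extendRank_coe {d : ℕ} (r : Fin (d + 1) → ℕ) (k : Fin (d + 1)) :
    extendRank r k = r k := dif_pos k.2

theorem mem_fixedTTRank_iff {d : ℕ} {n : Fin d → ℕ} {r : Fin (d + 1) → ℕ} (X : CTensor n) :
    X ∈ fixedTTRank n r ↔ extendRank r 0 = 1 ∧ extendRank r d = 1 ∧
      ∀ k, 0 < k → k < d → (X.unfolding k).rank = extendRank r k := by
  have hlast : extendRank r d = r (Fin.last d) := extendRank_coe r (Fin.last d)
  have hzero : extendRank r 0 = r 0 := extendRank_coe r 0
  rw [hlast, hzero]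
  constructor
  · rintro rfl
    refine ⟨by simp [CTensor.ttRank], by simp [CTensor.ttRank], fun k h0 hk => ?_⟩
    rw [extendRank, dif_pos (by omega), CTensor.ttRank, if_neg]
    rintro (h | h) <;> simp [Fin.ext_iff] at h <;> omega
  · rintro ⟨h0, hd, h⟩
    funext k
    rw [CTensor.ttRank]
    split_ifs with hk
    · rcases hk with rfl | rfl
      exacts [h0.symm, hd.symm]
    · rw [not_or] at hk
      rw [h k (Fin.pos_iff_ne_zero.2 hk.1) (Fin.val_lt_last hk.2), extendRank_coe]

theorem ttDim_eq {d : ℕ} (n : Fin d → ℕ) (r : Fin (d + 1) → ℕ) :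
    ttDim n r = ∑ m : Fin d, (extendRank r m : ℤ) * (n m : ℤ) * (extendRank r (m + 1) : ℤ) -
        ∑ k ∈ Finset.Ico 1 d, (extendRank r k : ℤ) ^ 2 := by
  rw [ttDim]
  congr 1
  · refine Finset.sum_congr rfl fun m _ => ?_
    rw [← extendRank_coe r m.castSucc, ← extendRank_coe r m.succ, Fin.val_castSucc, Fin.val_succ]
  · refine Finset.sum_bij (fun k _ => (k : ℕ)) ?_ ?_ ?_ ?_
    · intro k hk
      obtain ⟨h1, h2⟩ := Finset.mem_Ioo.1 hk
      simp only [Fin.lt_def, Fin.val_zero, Fin.val_last] at h1 h2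
      exact Finset.mem_Ico.2 ⟨h1, h2⟩
    · intro k _ l _ h
      exact Fin.ext h
    · intro k hk
      obtain ⟨h1, h2⟩ := Finset.mem_Ico.1 hk
      exact ⟨⟨k, by omega⟩, Finset.mem_Ioo.2 ⟨h1, h2⟩, rfl⟩
    · intro k _
      rw [extendRank_coe]

theorem smul_mem_fixedTTRank {d : ℕ} {n : Fin d → ℕ} {r : Fin (d + 1) → ℕ} {X : CTensor n}
    (hX : X ∈ fixedTTRank n r) {c : ℂ} (hc : c ≠ 0) : c • X ∈ fixedTTRank n r := by
  rw [mem_fixedTTRank_iff] at hX ⊢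
  refine ⟨hX.1, hX.2.1, fun k h0 hk => ?_⟩
  rw [← hX.2.2 k h0 hk]
  exact Matrix.rank_smul_of_mem_nonZeroDivisors (X.unfolding k) (mem_nonZeroDivisors_of_ne_zero hc)

theorem isEmbeddedSubmanifold_fixedTTRank {d : ℕ} (hd : 1 ≤ d) (n : Fin d → ℕ)
    (r : Fin (d + 1) → ℕ) : IsEmbeddedSubmanifold ℂ (fixedTTRank n r) (ttDim n r) := by
  classical
  intro X hX
  obtain ⟨h0, hlast, hrank⟩ := (mem_fixedTTRank_iff X).1 hX
  rw [ttDim_eq]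
  rcases isEmpty_or_nonempty (MultiIndex n) with hemp | hne
  · -- without multi-indices the tensor space is zero, and so are all inner ranks
    have hsub : Subsingleton (CTensor n) := (WithLp.equiv 2 (MultiIndex n → ℂ)).subsingleton
    have hR : ∀ k, 0 < k → k < d → extendRank r k = 0 := fun k hk0 hk => by
      rw [← hrank k hk0 hk, show X.unfolding k = 0 from
        Matrix.ext fun a b => hemp.elim ((Equiv.piEquivPiSubtypeProd
          (fun j : Fin d => (j : ℕ) < k) fun j => Fin (n j)).symm (a, b)), Matrix.rank_zero]
    refine ⟨0, Set.univ, fun _ => 0, ?_, isOpen_univ, trivial, contDiffOn_const, ?_,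
      fun w => ⟨0, Subsingleton.elim _ _⟩⟩
    · rw [Finset.sum_eq_zero, Finset.sum_eq_zero, Module.finrank_zero_of_subsingleton]
      · simp
      · intro k hk
        obtain ⟨h1, h2⟩ := Finset.mem_Ico.1 hk
        simp [hR k h1 h2]
      · intro m _
        rcases Nat.eq_zero_or_pos (m : ℕ) with hm | hm
        · by_cases hd1 : (m : ℕ) + 1 < d
          · simp [hR _ m.1.succ_pos hd1]
          · have : n m = 0 := by
              obtain ⟨j, hj⟩ := isEmpty_pi.1 hemp
              have : j = m := Fin.ext (by omega)
              subst this
              by_contra h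
              exact hj.elim ⟨0, Nat.pos_of_ne_zero h⟩
            simp [this]
        · simp [hR _ hm m.2]
    · intro y _
      rw [Subsingleton.elim y X]
      exact ⟨fun _ => rfl, fun _ => hX⟩
  · obtain ⟨p, hp⟩ := exists_nestedPivots X h0 hlast fun k hk0 hk => by
      rw [rank_flat, hrank k hk0 hk]
    rw [← p.card_support hd (fun k hk => p.rowsDistinct hp h0 hk)
      fun k hk0 hk => p.colsDistinct hp hlast hk0 hk]
    refine exists_local_equations_of_coordinate_retraction (· ∈ p.support) (p.retraction (d - 1))
      p.isOpen_domain (p.contDiffOn_retraction (by omega)) (fun y hy => ?_)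
      (fun y hy => (p.retraction_spec (by omega) hy).1)
      (fun y hy z hz h => p.retraction_congr h0 hd hlast hy hz h) hp
    rw [mem_fixedTTRank_iff, p.retraction_eq_self_iff hd hy]
    simp only [rank_flat, h0, hlast, true_and]

/-- At a point of the cone the radial direction supplies what the tangent space of the sphere
misses. -/
theorem intersectTransversally_fixedTTRank {d : ℕ} (n : Fin d → ℕ) (r : Fin (d + 1) → ℕ) :
    IntersectTransversally (fixedTTRank n r) (unitTensorSphere n) := by
  rintro X ⟨hX, hX1⟩ w
  have hX1 : ‖X‖ = 1 := hX1
  refine ⟨((inner ℝ X w : ℝ) : ℂ) • X,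
    smul_mem_tangentSpaceAt (fun Y hY c hc => smul_mem_fixedTTRank hY hc) hX _,
    w - (inner ℝ X w : ℝ) • X, mem_tangentSpaceAt_sphere hX1 ?_, ?_⟩
  · rw [inner_sub_right, inner_smul_right, real_inner_self_eq_norm_sq, hX1]
    ring
  · rw [Complex.coe_smul, add_sub_cancel]

theorem mainTheorem2 {d : ℕ} (hd : 1 ≤ d) (n : Fin d → ℕ) (r : Fin (d + 1) → ℕ) :
    IsEmbeddedSubmanifold ℂ (fixedTTRank n r) (ttDim n r) ∧
    IsEmbeddedSubmanifold ℝ (fixedTTRank n r) (2 * ttDim n r) ∧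
    IsEmbeddedSubmanifold ℝ (unitTensorSphere n) (2 * (∏ j, (n j : ℤ)) - 1) ∧
    fixedNTTRank n r = fixedTTRank n r ∩ unitTensorSphere n ∧
    (∀ X ∈ fixedTTRank n r, ∀ t : ℂ, t • X ∈ tangentSpaceAt (fixedTTRank n r) X) ∧
    IntersectTransversally (fixedTTRank n r) (unitTensorSphere n) ∧
    IsEmbeddedSubmanifold ℝ (fixedNTTRank n r) (2 * ttDim n r - 1) := by
  have hcpx := isEmbeddedSubmanifold_fixedTTRank hd n r
  have hreal : IsEmbeddedSubmanifold ℝ (fixedTTRank n r) (2 * ttDim n r) := hcpx.real_of_complex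
  refine ⟨hcpx, hreal, ?_, rfl,
    fun X hX t => smul_mem_tangentSpaceAt (fun Y hY c hc => smul_mem_fixedTTRank hY hc) hX t,
    intersectTransversally_fixedTTRank n r, ?_⟩
  · have hdim : (2 * (∏ j, (n j : ℤ)) : ℤ) = Module.finrank ℝ (CTensor n) := by
      rw [← Module.finrank_mul_finrank ℝ ℂ (CTensor n), Complex.finrank_real_complex,
        finrank_euclideanSpace, Fintype.card_pi]
      simp
    have h := (isEmbeddedSubmanifold_univ (𝕜 := ℝ) (E := CTensor n)).inter_sphere
      fun _ _ _ _ => trivial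
    rw [Set.univ_inter] at h
    rw [hdim]
    exact h
  · refine hreal.inter_sphere fun X hX t ht => ?_
    rw [← Complex.coe_smul]
    exact smul_mem_fixedTTRank hX (Complex.ofReal_ne_zero.2 ht.ne')
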